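/- Solitaire memory is played with a deck of $2n$ cards labelled by $1,\dots,n$, each label appearing on exactly two cards. The deck is shuffled (all arrangements of the multiset $\{1,1,2,2,\dots,n,n\}$ in a row being equally likely) and the cards are laid face down in a row. A move consists of flipping first one card and then a second; if they match they are removed, and otherwise they are turned face down again. The game ends when all cards have been removed, and its length is the total number of moves. The player has perfect memory and makes each move by the following strategy. If the positions of both cards of a pair on the table are known (both have been flipped before), she flips and removes them. Otherwise she flips the leftmost card that has never been flipped; if the position of its mate is known, she flips the mate and removes both; if not, she flips the next leftmost card that has never been flipped, and removes the two cards if they happen to match. Then the expected length of a game with $2n$ cards is $$(3-2\ln 2)\,n+\frac78-2\ln 2+\varepsilon_n,$$ where $\lim_{n\to\infty}\varepsilon_n=0$; moreover $\varepsilon_n=O(1/\sqrt n)$ as $n\to\infty$. -/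

import Mathlib

namespace SolitaireMemory

/-- A deal of a deck of `2 * n` cards: a row of `2 * n` labels in which each of the `n` labels
occurs exactly twice, i.e. an arrangement of the multiset `{1, 1, 2, 2, …, n, n}`. -/
abbrev Deal (n : ℕ) : Type :=
  {σ : Fin (2 * n) → Fin n // ∀ a : Fin n, (Finset.univ.filter fun i => σ i = a).card = 2}

/-- The number of moves still to be made by a player with perfect memory who follows the strategy
below. Here `known` lists the cards that are still on the table and have been flipped before, and
`unknown` is the row, from left to right, of the cards that have never been flipped. The value is
the total number of moves from this situation on; every move contributes one summand `1`.

* If both cards of a pair are known, they are flipped and removed.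
* Otherwise the leftmost unknown card `x` is flipped. If its mate is known, the mate is flipped and
  both are removed. If not, the next unknown card `y` is flipped; the two cards are removed if they
  match, and are turned back (and remembered) if they do not.

The case of a single unknown card without a known mate never arises from a deal. -/
def movesLeft {α : Type*} [DecidableEq α] (known unknown : List α) : ℕ :=
  match h : known.find? (fun a => 2 ≤ known.count a) with
  | some a => 1 + movesLeft ((known.erase a).erase a) unknown
  | none =>
    match unknown with
    | [] => 0
    | x :: rest =>
      if x ∈ known then 1 + movesLeft (known.erase x) rest
      else
        match rest with
        | [] => 1
        | y :: rest' =>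
          if x = y then 1 + movesLeft known rest'
          else 1 + movesLeft (x :: y :: known) rest'
  termination_by known.length + 2 * unknown.length
  decreasing_by
    · have ha : a ∈ known := List.mem_of_find?_eq_some h
      have h1 := List.length_erase_of_mem ha
      have h2 := List.length_pos_of_mem ha
      have h3 := (List.erase_sublist (a := a) (l := known.erase a)).length_le
      omega
    · have h3 := (List.erase_sublist (a := x) (l := known)).length_le
      simp only [List.length_cons]
      omega
    · simp only [List.length_cons]
      omega
    · simp only [List.length_cons]
      omega

/-- The length of the game played on a deal: at the start no card is known. -/
def gameLength {n : ℕ} (σ : Deal n) : ℕ :=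
  movesLeft [] (List.ofFn σ.1)

/-- The expected length of a game with `2 * n` cards, all deals being equally likely. -/
noncomputable def expectedLength (n : ℕ) : ℝ :=
  (∑ σ : Deal n, (gameLength σ : ℝ)) / (Fintype.card (Deal n) : ℝ)

end SolitaireMemory

/-!
Mark each card of the row as new or old according to whether it is the first or the second card of
its label. An old leftmost unknown card is removed at once; two new cards take one move; a new card
followed by an old one takes one move, and a further one to remove the pair of the old card unless
the two cards happen to match. A maximal run of `r` new cards thus costs `⌈r / 2⌉` moves on top of
the `n` moves that remove the old cards, and every lucky match saves one. Now `⌈r / 2⌉` is the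
number of gaps in front of cards of the run that are followed by an odd number of new cards, and
deleting a lucky pair leaves a smaller deal with a distinguished gap preceded by an even number of
cards of a run; each run has as many such gaps as gaps followed by an even number of its cards.
Hence both expectations are expressed by the probability that a random gap is followed by an even
run, for which there is an explicit alternating sum. The resulting closed form for the expected
number of moves is verified through the recurrences obtained by conditioning on the next card.

For a fresh deck the alternating sum tends to `∑ (-1) ^ l / (l + 1) = log 2`. Its increments are
controlled by a first-order linear recurrence, which makes the next term `1 / (16 * n)` explicit
with an error of order `1 / n ^ 2`.
-/

namespace SolitaireMemory

open Finset Filter Topology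
open scoped BigOperators

/-! ### Runs of new labels -/

/-- When `s` cards are unknown and the mates of exactly `2 * j` of them are unknown too, the
probability that the next `l` unknown cards carry `l` distinct labels none of which is known. The
number of cards is a real parameter so that the relations below need no casts. -/
noncomputable def runProb (s : ℝ) (j l : ℕ) : ℝ :=
  ∏ i ∈ range l, 2 * ((j : ℝ) - i) / (s - i)

/-- The probability that the maximal run of new labels at the beginning of the `s` unknown cards
has even length, as the alternating sum of the probabilities that its length is at least `l`. -/
noncomputable def evenRunProb (s : ℝ) (j : ℕ) : ℝ :=
  ∑ l ∈ range (j + 1), (-1) ^ l * runProb s j l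

/-- The probability that a uniformly random one of the `s + 1` gaps between, before and after the
`s` unknown cards is followed by a maximal run of new labels of even length, as the alternating
sum of the probabilities `runProb (s + 1) j l / (l + 1)` that this run has length at least `l`. -/
noncomputable def evenGapProb (s : ℝ) (j : ℕ) : ℝ :=
  ∑ l ∈ range (j + 1), (-1) ^ l * (runProb (s + 1) j l / (l + 1))

/-- The expected number of moves that remove two cards neither of which was known before. At
`j = 0` the first factor vanishes, so that the truncated `j - 1` does no harm. -/
noncomputable def luckyMatches (s : ℝ) (j : ℕ) : ℝ :=
  2 * j / s * evenGapProb (s - 2) (j - 1)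

/-- The expected number of moves still to be made when `s` cards are unknown and the mates of
`2 * j` of them are unknown too. -/
noncomputable def expectedMoves (s : ℝ) (j : ℕ) : ℝ :=
  2 * s - j + 1 - (s + 1) * evenGapProb s j - luckyMatches s j

/-- The expected number of moves still to be made, the current one included, when the first card
of the current move has just turned out to carry a new label; `s` and `j` count the other unknown
cards as in `expectedMoves`, so that the mate of the flipped card is one of the `s - 2 * j`. -/
noncomputable def expectedMovesPending (s : ℝ) (j : ℕ) : ℝ :=
  expectedMoves s j + evenRunProb s j - evenRunProb (s - 1) j / s

theorem runProb_zero (s : ℝ) (j : ℕ) : runProb s j 0 = 1 := prod_range_zero _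

theorem runProb_succ (s : ℝ) (j l : ℕ) :
    runProb s j (l + 1) = runProb s j l * (2 * (j - l) / (s - l)) := prod_range_succ _ _

theorem runProb_eq_zero_of_lt (s : ℝ) {j l : ℕ} (h : j < l) : runProb s j l = 0 :=
  prod_eq_zero (mem_range.2 h) (by simp)

theorem runProb_succ_succ (s : ℝ) (j l : ℕ) :
    runProb s (j + 1) (l + 1) = 2 * (j + 1) / s * runProb (s - 1) j l := by
  rw [runProb, prod_range_succ', mul_comm, runProb]
  congr 1
  · simp
  · refine prod_congr rfl fun i _ => ?_
    push_cast
    rw [add_sub_add_right_eq_sub, sub_sub, add_comm (1 : ℝ)]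

theorem sub_mul_runProb_succ (s : ℝ) (j l : ℕ) :
    (j + 1 - l) * runProb s (j + 1) l = (j + 1) * runProb s j l := by
  induction l with
  | zero => simp [runProb_zero]
  | succ l ih =>
    rw [runProb_succ, runProb_succ]
    push_cast
    linear_combination 2 * ((j : ℝ) - l) / (s - l) * ih

theorem runProb_mul_sub {s : ℝ} {j l : ℕ} (hl : l ≤ j) (hj : (j : ℝ) ≤ s) :
    runProb s j l * (s + 1 - l) = runProb (s + 1) j l * (s + 1) := by
  induction l with
  | zero => simp [runProb_zero]
  | succ l ih =>
    have hls : (l : ℝ) + 1 ≤ s := le_trans (by exact_mod_cast hl) hj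
    have hs : s - l ≠ 0 := by linarith
    have hs' : s + 1 - l ≠ 0 := by linarith
    rw [runProb_succ, runProb_succ]
    push_cast
    rw [add_sub_add_right_eq_sub]
    field_simp
    linear_combination ((j : ℝ) - l) * ih (by omega)

theorem sum_range_mul_runProb (c : ℕ → ℝ) (s : ℝ) {j m : ℕ} (h : j + 1 ≤ m) :
    ∑ l ∈ range (j + 1), c l * runProb s j l = ∑ l ∈ range m, c l * runProb s j l :=
  sum_subset (range_subset_range.2 h) fun l _ hl => by
    rw [runProb_eq_zero_of_lt s (by simpa using hl), mul_zero]

theorem evenRunProb_zero_right (s : ℝ) : evenRunProb s 0 = 1 := by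
  simp [evenRunProb, runProb_zero]

theorem evenGapProb_zero_right (s : ℝ) : evenGapProb s 0 = 1 := by
  simp [evenGapProb, runProb_zero]

/-- The initial run has odd length exactly when the first card is new and an even run follows. -/
theorem evenRunProb_eq_first_card (s : ℝ) (j : ℕ) :
    evenRunProb s j + 2 * j / s * evenRunProb (s - 1) (j - 1) = 1 := by
  obtain - | j := j
  · simp [evenRunProb_zero_right]
  have tail : ∑ l ∈ range (j + 1), (-1) ^ (l + 1) * runProb s (j + 1) (l + 1)
      = -(2 * (j + 1) / s * evenRunProb (s - 1) j) := by
    rw [evenRunProb, mul_sum, ← sum_neg_distrib]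
    refine sum_congr rfl fun l _ => ?_
    rw [runProb_succ_succ]
    ring
  rw [evenRunProb, sum_range_succ', tail, runProb_zero, Nat.add_sub_cancel]
  push_cast
  ring

theorem mul_evenRunProb {s : ℝ} (hs : s ≠ 0) (j : ℕ) :
    s * evenRunProb s j + 2 * j * evenRunProb (s - 1) (j - 1) = s := by
  have first_card := evenRunProb_eq_first_card s j
  field_simp at first_card
  linear_combination first_card

theorem runProb_pascal {s : ℝ} {j l : ℕ} (hl : l ≤ j) (hj : (j : ℝ) ≤ s) :
    runProb (s + 1) (j + 1) (l + 1) - runProb (s + 1) j (l + 1)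
      = 2 * (s + 2) / (s + 1) * runProb s j l - 2 * runProb (s + 1) j l := by
  have hls : (l : ℝ) ≤ s := le_trans (by exact_mod_cast hl) hj
  have hs : s + 1 ≠ 0 := by linarith [l.cast_nonneg (α := ℝ)]
  have hs' : s + 1 - l ≠ 0 := by linarith
  rw [runProb_succ_succ, runProb_succ, add_sub_cancel_right]
  field_simp
  linear_combination (j - s - 1) * runProb_mul_sub hl hj

theorem evenRunProb_pascal {s : ℝ} {j : ℕ} (hj : (j : ℝ) ≤ s) :
    evenRunProb (s + 1) (j + 1)
      = 3 * evenRunProb (s + 1) j - 2 * (s + 2) / (s + 1) * evenRunProb s j := by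
  have diff : evenRunProb (s + 1) (j + 1) - evenRunProb (s + 1) j
      = ∑ l ∈ range (j + 1),
          (-1) ^ (l + 1) * (runProb (s + 1) (j + 1) (l + 1) - runProb (s + 1) j (l + 1)) := by
    rw [evenRunProb, evenRunProb, sum_range_mul_runProb _ _ (Nat.le_succ (j + 1)),
      ← sum_sub_distrib, sum_range_succ']
    simp [runProb_zero, mul_sub]
  have pascal : evenRunProb (s + 1) (j + 1) - evenRunProb (s + 1) j
      = 2 * evenRunProb (s + 1) j - 2 * (s + 2) / (s + 1) * evenRunProb s j := by
    rw [diff, evenRunProb, evenRunProb, mul_sum, mul_sum, ← sum_sub_distrib]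
    refine sum_congr rfl fun l hl => ?_
    rw [runProb_pascal (Nat.lt_succ_iff.1 (mem_range.1 hl)) hj]
    ring
  linear_combination pascal

theorem evenGapProb_add_one {s : ℝ} {j : ℕ} (hj : (j : ℝ) ≤ s + 1) :
    (s + 2) * evenGapProb (s + 1) j + evenRunProb (s + 1) j = (s + 3) * evenGapProb s j := by
  rw [evenGapProb, evenRunProb, evenGapProb, mul_sum, mul_sum, ← sum_add_distrib]
  refine sum_congr rfl fun l hl => ?_
  have shift := runProb_mul_sub (Nat.lt_succ_iff.1 (mem_range.1 hl)) hj
  field_simp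
  linear_combination -shift

theorem succ_mul_evenGapProb (s : ℝ) (j : ℕ) :
    (j + 1) * evenGapProb s j = evenRunProb (s + 1) j + j * evenGapProb s (j - 1) := by
  obtain - | j := j
  · simp [evenGapProb_zero_right, evenRunProb_zero_right]
  have extend : evenGapProb s j
      = ∑ l ∈ range (j + 2), (-1) ^ l * (runProb (s + 1) j l / (l + 1)) := by
    simpa only [evenGapProb, div_mul_eq_mul_div, mul_div_assoc] using
      sum_range_mul_runProb (fun l => (-1) ^ l / ((l : ℝ) + 1)) (s + 1) (Nat.le_succ (j + 1))
  rw [Nat.add_sub_cancel, extend, evenGapProb, evenRunProb, mul_sum, mul_sum, ← sum_add_distrib]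
  refine sum_congr rfl fun l _ => ?_
  have absorb := sub_mul_runProb_succ (s + 1) j l
  push_cast
  field_simp
  linear_combination absorb

theorem evenGapProb_eq_first_card {s : ℝ} {j : ℕ} (hj : (j : ℝ) ≤ s) :
    (s + 1) * evenGapProb s j
      = evenRunProb s j + (s - 2 * j) * evenGapProb (s - 1) j
        + 2 * j * evenGapProb (s - 1) (j - 1) := by
  have longer := evenGapProb_add_one (s := s - 1) (j := j) (by linarith)
  have fewer := succ_mul_evenGapProb (s - 1) j
  rw [sub_add_cancel] at longer fewer
  linear_combination longer + 2 * fewer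

theorem luckyMatches_eq_first_card {s : ℝ} {j : ℕ} (hj : 2 * (j : ℝ) ≤ s) :
    s * luckyMatches s j
      = (s - 2 * j) * luckyMatches (s - 1) j
        + 2 * j * (luckyMatches (s - 1) (j - 1) + evenRunProb (s - 2) (j - 1) / (s - 1)) := by
  obtain - | j := j
  · simp [luckyMatches]
  push_cast at hj
  have hs : s ≠ 0 := by linarith [j.cast_nonneg (α := ℝ)]
  have hs' : s - 1 ≠ 0 := by linarith [j.cast_nonneg (α := ℝ)]
  have first_card := evenGapProb_eq_first_card (s := s - 2) (j := j)
    (by linarith [j.cast_nonneg (α := ℝ)])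
  simp only [luckyMatches, Nat.add_sub_cancel, sub_right_comm s 1 2]
  push_cast
  field_simp
  linear_combination first_card

theorem expectedMoves_zero_right (s : ℝ) : expectedMoves s 0 = s := by
  simp only [expectedMoves, luckyMatches, evenGapProb_zero_right, Nat.cast_zero]
  ring

theorem expectedMoves_eq_first_card {s : ℝ} {j : ℕ} (hs : s ≠ 0) (hj : 2 * (j : ℝ) ≤ s) :
    s * expectedMoves s j
      = (s - 2 * j) * (1 + expectedMoves (s - 1) j)
        + 2 * j * expectedMovesPending (s - 1) (j - 1) := by
  obtain - | j := j
  · rw [expectedMoves_zero_right, expectedMoves_zero_right]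
    simp
  have gaps := evenGapProb_eq_first_card (s := s) (j := j + 1)
    (by linarith [(j + 1).cast_nonneg (α := ℝ)])
  have lucky := luckyMatches_eq_first_card hj
  have run := mul_evenRunProb hs (j + 1)
  simp only [expectedMoves, expectedMovesPending, Nat.add_sub_cancel, sub_sub s 1 1,
    one_add_one_eq_two] at gaps lucky run ⊢
  push_cast at gaps lucky run ⊢
  linear_combination -s * gaps - lucky - run

theorem expectedMovesPending_eq_second_card {s : ℝ} {j : ℕ} (hj : 2 * (j : ℝ) + 1 ≤ s) :
    s * expectedMovesPending s j
      = 1 + expectedMoves (s - 1) j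
        + (s - 2 * j - 1) * (2 + expectedMoves (s - 1) j)
        + 2 * j * (1 + expectedMoves (s - 1) (j - 1)) := by
  have hs : s ≠ 0 := by linarith [j.cast_nonneg (α := ℝ)]
  have moves := expectedMoves_eq_first_card hs (j := j) (by linarith)
  have run := mul_evenRunProb hs j
  have run' := evenRunProb_eq_first_card (s - 1) j
  have cancel : s * (evenRunProb (s - 1) j / s) = evenRunProb (s - 1) j := mul_div_cancel₀ _ hs
  rw [expectedMovesPending] at moves ⊢
  linear_combination moves + run - run' - cancel

/-! ### Random arrangements -/

theorem sum_map_eq_card_mul {β : Type*} {s : Multiset β} {f : β → ℝ} {c : ℝ}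
    (h : ∀ x ∈ s, f x = c) : (s.map f).sum = Multiset.card s * c := by
  rw [Multiset.map_congr rfl h, Multiset.map_const', Multiset.sum_replicate, nsmul_eq_mul]

section Arrangements

variable {α : Type*} [DecidableEq α]

/-- The rows in which the cards of a multiset can be laid out. Equal cards are not distinguished:
each row occurs once. -/
def arrangements (s : Multiset α) : Finset (List α) := s.lists.toFinset

theorem mem_arrangements {s : Multiset α} {l : List α} :
    l ∈ arrangements s ↔ (l : Multiset α) = s := by
  simp [arrangements, eq_comm]

theorem arrangements_nonempty (s : Multiset α) : (arrangements s).Nonempty :=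
  ⟨s.toList, mem_arrangements.2 s.coe_toList⟩

theorem arrangements_zero : arrangements (0 : Multiset α) = {[]} := by
  ext l
  simp [mem_arrangements]

theorem sum_arrangements {M : Type*} [AddCommMonoid M] {s : Multiset α} (hs : s ≠ 0)
    (F : List α → M) :
    ∑ l ∈ arrangements s, F l =
      ∑ x ∈ s.toFinset, ∑ l ∈ arrangements (s.erase x), F (x :: l) := by
  rw [Finset.sum_sigma']
  symm
  refine Finset.sum_bij (fun p _ => p.1 :: p.2) ?_ ?_ ?_ fun _ _ => rfl
  · rintro ⟨x, l⟩ h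
    simp only [mem_sigma, Multiset.mem_toFinset, mem_arrangements] at h
    rw [mem_arrangements, ← Multiset.cons_coe, h.2, Multiset.cons_erase h.1]
  · rintro ⟨x, l⟩ _ ⟨x', l'⟩ _ h
    obtain ⟨rfl, rfl⟩ := List.cons.inj h
    rfl
  · intro l hl
    rw [mem_arrangements] at hl
    obtain - | ⟨x, l⟩ := l
    · exact absurd hl.symm hs
    · subst hl
      exact ⟨⟨x, l⟩, by simp [mem_arrangements], rfl⟩

theorem sum_card_arrangements_erase {s : Multiset α} (hs : s ≠ 0) :
    ∑ x ∈ s.toFinset, #(arrangements (s.erase x)) = #(arrangements s) := by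
  simp only [card_eq_sum_ones, sum_arrangements hs]

theorem count_succ_mul_card_arrangements_cons (x : α) (s : Multiset α) :
    (s.count x + 1) * #(arrangements (x ::ₘ s)) = (Multiset.card s + 1) * #(arrangements s) := by
  induction h : Multiset.card s generalizing s with
  | zero =>
    obtain rfl := Multiset.card_eq_zero.1 h
    simpa using (sum_card_arrangements_erase (Multiset.singleton_ne_zero x)).symm
  | succ n ih =>
    have hs : s ≠ 0 := by
      rintro rfl
      simp at h
    have card_erase {y : α} (hy : y ∈ s) : Multiset.card (s.erase y) = n := by
      rw [Multiset.card_erase_of_mem hy, h, Nat.pred_succ]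
    have first_ne : ∀ y ∈ s.toFinset.erase x,
        (s.count x + 1) * #(arrangements ((x ::ₘ s).erase y))
          = (n + 1) * #(arrangements (s.erase y)) := fun y hy => by
      obtain ⟨hyx, hys⟩ := mem_erase.1 hy
      rw [Multiset.erase_cons_tail _ hyx.symm, ← ih _ (card_erase (Multiset.mem_toFinset.1 hys)),
        Multiset.count_erase_of_ne hyx.symm]
    have first_eq : s.count x * #(arrangements s)
        = (n + 1) * if x ∈ s then #(arrangements (s.erase x)) else 0 := by
      split_ifs with hx
      · rw [← ih _ (card_erase hx), Multiset.cons_erase hx, Multiset.count_erase_self,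
          Nat.sub_add_cancel (Multiset.count_pos.2 hx)]
      · rw [Multiset.count_eq_zero_of_notMem hx, zero_mul, mul_zero]
    have split_first : ∑ y ∈ s.toFinset.erase x, #(arrangements (s.erase y))
        + (if x ∈ s then #(arrangements (s.erase x)) else 0) = #(arrangements s) := by
      rw [← sum_card_arrangements_erase hs]
      split_ifs with hx
      · exact sum_erase_add _ _ (Multiset.mem_toFinset.2 hx)
      · rw [erase_eq_of_notMem (by simpa using hx), add_zero]
    have toFinset_cons : (x ::ₘ s).toFinset = insert x (s.toFinset.erase x) := by
      ext y
      by_cases hy : y = x <;> simp [hy]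
    rw [← sum_card_arrangements_erase Multiset.cons_ne_zero, toFinset_cons,
      sum_insert (notMem_erase x _), Multiset.erase_cons_head, mul_add, mul_sum,
      sum_congr rfl first_ne, ← mul_sum]
    linear_combination first_eq + (n + 1) * split_first

theorem count_mul_card_arrangements {x : α} {s : Multiset α} (hx : x ∈ s) :
    s.count x * #(arrangements s) = Multiset.card s * #(arrangements (s.erase x)) := by
  simpa [hx, Multiset.cons_erase hx, Nat.sub_add_cancel (Multiset.count_pos.2 hx),
    Nat.sub_add_cancel (Multiset.card_pos_iff_exists_mem.2 ⟨x, hx⟩)]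
    using count_succ_mul_card_arrangements_cons x (s.erase x)

theorem card_mul_expect_arrangements (s : Multiset α) (F : List α → ℝ) :
    Multiset.card s * 𝔼 l ∈ arrangements s, F l
      = (s.map fun x => 𝔼 l ∈ arrangements (s.erase x), F (x :: l)).sum := by
  obtain rfl | hs := eq_or_ne s 0
  · simp
  have card_ne_zero (t : Multiset α) : (#(arrangements t) : ℝ) ≠ 0 :=
    Nat.cast_ne_zero.2 (arrangements_nonempty t).card_ne_zero
  rw [expect_eq_sum_div_card, sum_arrangements hs, Finset.sum_multiset_map_count, sum_div, mul_sum]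
  refine sum_congr rfl fun x hx => ?_
  have ratio : (s.count x : ℝ) * #(arrangements s)
      = Multiset.card s * #(arrangements (s.erase x)) := mod_cast
    count_mul_card_arrangements (Multiset.mem_toFinset.1 hx)
  rw [expect_eq_sum_div_card, nsmul_eq_mul]
  have := card_ne_zero s
  have := card_ne_zero (s.erase x)
  field_simp
  linear_combination -(∑ l ∈ arrangements (s.erase x), F (x :: l)) * ratio

theorem expect_natCast_add (s : Multiset α) (c : ℕ) (f : List α → ℕ) :
    𝔼 l ∈ arrangements s, ((c + f l : ℕ) : ℝ) = c + 𝔼 l ∈ arrangements s, (f l : ℝ) := by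
  simp only [Nat.cast_add, expect_add_distrib, expect_const (arrangements_nonempty s)]

/-- The unknown cards when `K` lists the labels with exactly one known card and `J` those with
none. -/
def unknownCards (K J : Multiset α) : Multiset α := K + 2 • J

theorem unknownCards_erase_known {K : Multiset α} {x : α} (hx : x ∈ K) (J : Multiset α) :
    (unknownCards K J).erase x = unknownCards (K.erase x) J :=
  Multiset.erase_add_left_pos _ hx

theorem unknownCards_erase_new (K : Multiset α) {x : α} {J : Multiset α} (hx : x ∈ J) :
    (unknownCards K J).erase x = unknownCards (x ::ₘ K) (J.erase x) := by
  obtain ⟨J, rfl⟩ := Multiset.exists_cons_of_mem hx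
  simp [unknownCards, two_nsmul]

theorem expect_unknownCards (K J : Multiset α) (F : List α → ℝ) :
    (Multiset.card K + 2 * Multiset.card J) * 𝔼 l ∈ arrangements (unknownCards K J), F l
      = (K.map fun x => 𝔼 l ∈ arrangements (unknownCards (K.erase x) J), F (x :: l)).sum
        + 2 * (J.map fun x =>
            𝔼 l ∈ arrangements (unknownCards (x ::ₘ K) (J.erase x)), F (x :: l)).sum := by
  have known : K.map (fun x => 𝔼 l ∈ arrangements ((unknownCards K J).erase x), F (x :: l))
      = K.map fun x => 𝔼 l ∈ arrangements (unknownCards (K.erase x) J), F (x :: l) :=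
    Multiset.map_congr rfl fun x hx => by rw [unknownCards_erase_known hx]
  have new : J.map (fun x => 𝔼 l ∈ arrangements ((unknownCards K J).erase x), F (x :: l))
      = J.map fun x => 𝔼 l ∈ arrangements (unknownCards (x ::ₘ K) (J.erase x)), F (x :: l) :=
    Multiset.map_congr rfl fun x hx => by rw [unknownCards_erase_new K hx]
  rw [← known, ← new]
  simpa [unknownCards, Multiset.map_nsmul, Multiset.sum_nsmul]
    using card_mul_expect_arrangements (unknownCards K J) F

theorem expect_unknownCards_of_forall_eq {K J : Multiset α} {F : List α → ℝ} {a b : ℝ}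
    (known : ∀ x ∈ K, 𝔼 l ∈ arrangements (unknownCards (K.erase x) J), F (x :: l) = a)
    (new : ∀ x ∈ J, 𝔼 l ∈ arrangements (unknownCards (x ::ₘ K) (J.erase x)), F (x :: l) = b) :
    (Multiset.card K + 2 * Multiset.card J) * 𝔼 l ∈ arrangements (unknownCards K J), F l
      = Multiset.card K * a + 2 * Multiset.card J * b := by
  rw [expect_unknownCards, sum_map_eq_card_mul known, sum_map_eq_card_mul new, mul_assoc]

theorem expect_unknownCards_cons_of_forall_eq {K J : Multiset α} {x : α} {F : List α → ℝ}
    {a b c : ℝ} (mate : 𝔼 l ∈ arrangements (unknownCards K J), F (x :: l) = a)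
    (known : ∀ y ∈ K, 𝔼 l ∈ arrangements (unknownCards ((x ::ₘ K).erase y) J), F (y :: l) = b)
    (new : ∀ y ∈ J, 𝔼 l ∈ arrangements (unknownCards (y ::ₘ x ::ₘ K) (J.erase y)),
      F (y :: l) = c) :
    (Multiset.card K + 1 + 2 * Multiset.card J)
        * 𝔼 l ∈ arrangements (unknownCards (x ::ₘ K) J), F l
      = a + Multiset.card K * b + 2 * Multiset.card J * c := by
  have average := expect_unknownCards (x ::ₘ K) J F
  rwa [Multiset.map_cons, Multiset.sum_cons, Multiset.erase_cons_head, mate,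
    sum_map_eq_card_mul known, sum_map_eq_card_mul new, Multiset.card_cons, Nat.cast_succ,
    ← mul_assoc] at average

end Arrangements

/-! ### The expected length of a game -/

section Moves

variable {α : Type*} [DecidableEq α] {K : List α} {x y : α}

theorem find?_two_le_count_eq_none (hK : K.Nodup) :
    K.find? (fun a => 2 ≤ K.count a) = none :=
  List.find?_eq_none.2 fun a _ => by
    simpa using Nat.lt_succ_iff.2 (List.nodup_iff_count_le_one.1 hK a)

theorem movesLeft_nil (hK : K.Nodup) : movesLeft K [] = 0 := by
  rw [movesLeft.eq_def]
  split
  · next h => simp [find?_two_le_count_eq_none hK] at h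
  · rfl

theorem movesLeft_cons (hK : K.Nodup) (x : α) (l : List α) :
    movesLeft K (x :: l) =
      if x ∈ K then 1 + movesLeft (K.erase x) l
      else match l with
        | [] => 1
        | y :: l => if x = y then 1 + movesLeft K l else 1 + movesLeft (x :: y :: K) l := by
  rw [movesLeft.eq_def]
  split
  · next h => simp [find?_two_le_count_eq_none hK] at h
  · rfl

theorem movesLeft_cons_of_mem (hK : K.Nodup) (hx : x ∈ K) (l : List α) :
    movesLeft K (x :: l) = 1 + movesLeft (K.erase x) l := by
  rw [movesLeft_cons hK, if_pos hx]

theorem movesLeft_cons_cons_self (hK : K.Nodup) (hx : x ∉ K) (l : List α) :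
    movesLeft K (x :: x :: l) = 1 + movesLeft K l := by
  rw [movesLeft_cons hK, if_neg hx]
  exact if_pos rfl

theorem movesLeft_cons_cons_of_ne (hK : K.Nodup) (hx : x ∉ K) (hxy : x ≠ y) (l : List α) :
    movesLeft K (x :: y :: l) = 1 + movesLeft (x :: y :: K) l := by
  rw [movesLeft_cons hK, if_neg hx]
  exact if_neg hxy

theorem movesLeft_of_known_pair (hy : 2 ≤ K.count y) (hK : (K.erase y).Nodup) (l : List α) :
    movesLeft K l = 1 + movesLeft ((K.erase y).erase y) l := by
  rw [movesLeft.eq_def]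
  split
  · next a h =>
    have ha : 2 ≤ K.count a := by simpa using List.find?_some h
    obtain rfl : a = y := by
      by_contra hay
      have := List.nodup_iff_count_le_one.1 hK a
      rw [List.count_erase_of_ne hay] at this
      omega
    rfl
  · next h =>
    have hyK : y ∈ K := List.count_pos_iff.1 (by omega)
    simpa [hy] using List.find?_eq_none.1 h y hyK

theorem movesLeft_cons_cons_of_mem (hK : K.Nodup) (hx : x ∉ K) (hy : y ∈ K) (l : List α) :
    movesLeft K (x :: y :: l) = 2 + movesLeft (x :: K.erase y) l := by
  have hxy : x ≠ y := (ne_of_mem_of_not_mem hy hx).symm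
  have erase_pair : (x :: y :: K).erase y = x :: K := by simp [hxy]
  rw [movesLeft_cons_cons_of_ne hK hx hxy,
    movesLeft_of_known_pair (y := y) (by simpa [hxy] using hy)
    (by rw [erase_pair]; exact List.nodup_cons.2 ⟨hx, hK⟩), erase_pair,
    List.erase_cons_tail (by simpa using hxy), ← add_assoc]

/-- The expected number of moves still to be made when exactly one card of each label in `K` is
known, the mates of these cards and all cards with a label in `J` are unknown, and the unknown
cards lie in random order. -/
noncomputable def expectedMovesLeft (K : List α) (J : Multiset α) : ℝ :=
  𝔼 l ∈ arrangements (unknownCards K J), (movesLeft K l : ℝ)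

theorem expect_movesLeft_cons_of_mem (hK : K.Nodup) (hx : x ∈ K) (J : Multiset α) :
    𝔼 l ∈ arrangements (unknownCards ((K : Multiset α).erase x) J), (movesLeft K (x :: l) : ℝ)
      = 1 + expectedMovesLeft (K.erase x) J := by
  simp only [movesLeft_cons_of_mem hK hx]
  rw [expect_natCast_add, Nat.cast_one, Multiset.coe_erase, expectedMovesLeft]

theorem expect_movesLeft_cons_cons_self (hK : K.Nodup) (hx : x ∉ K) (J : Multiset α) :
    𝔼 l ∈ arrangements (unknownCards K J), (movesLeft K (x :: x :: l) : ℝ)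
      = 1 + expectedMovesLeft K J := by
  simp only [movesLeft_cons_cons_self hK hx]
  rw [expect_natCast_add, Nat.cast_one, expectedMovesLeft]

theorem expect_movesLeft_cons_cons_of_mem (hK : K.Nodup) (hx : x ∉ K) (hy : y ∈ K)
    (J : Multiset α) :
    𝔼 l ∈ arrangements (unknownCards ((x ::ₘ ↑K).erase y) J), (movesLeft K (x :: y :: l) : ℝ)
      = 2 + expectedMovesLeft (x :: K.erase y) J := by
  simp only [movesLeft_cons_cons_of_mem hK hx hy]
  rw [expect_natCast_add, Nat.cast_two,
    Multiset.erase_cons_tail _ (ne_of_mem_of_not_mem hy hx).symm, Multiset.coe_erase,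
    Multiset.cons_coe, expectedMovesLeft]

theorem expect_movesLeft_cons_cons_of_ne (hK : K.Nodup) (hx : x ∉ K) (hxy : x ≠ y)
    (J : Multiset α) :
    𝔼 l ∈ arrangements (unknownCards (y ::ₘ x ::ₘ ↑K) J), (movesLeft K (x :: y :: l) : ℝ)
      = 1 + expectedMovesLeft (x :: y :: K) J := by
  simp only [movesLeft_cons_cons_of_ne hK hx hxy]
  rw [expect_natCast_add, Nat.cast_one, Multiset.cons_swap, Multiset.cons_coe, Multiset.cons_coe,
    expectedMovesLeft]

theorem expect_movesLeft_cons {m : ℕ}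
    (ih : ∀ (K : List α) (J : Multiset α), (↑K + J).Nodup →
      K.length + 2 * Multiset.card J + 1 = m →
      expectedMovesLeft K J = expectedMoves (m - 1) (Multiset.card J))
    {J : Multiset α} (hd : (x ::ₘ (↑K + J)).Nodup)
    (hm : K.length + 2 * Multiset.card J + 1 = m) :
    𝔼 l ∈ arrangements (unknownCards (x ::ₘ ↑K) J), (movesLeft K (x :: l) : ℝ)
      = expectedMovesPending m (Multiset.card J) := by
  obtain ⟨hx, hKJ⟩ := Multiset.nodup_cons.1 hd
  have hK : K.Nodup := Multiset.nodup_of_le (Multiset.le_add_right _ _) hKJ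
  have hxK : x ∉ K := fun h => hx (Multiset.mem_add.2 (Or.inl h))
  have known : ∀ y ∈ K,
      expectedMovesLeft (x :: K.erase y) J = expectedMoves (m - 1) (Multiset.card J) := by
    intro y hy
    refine ih _ J ?_ (by rw [← hm, List.length_cons, List.length_erase_add_one hy])
    rw [← Multiset.cons_coe, ← Multiset.coe_erase, Multiset.cons_add]
    exact Multiset.nodup_of_le
      (Multiset.cons_le_cons x (Multiset.add_le_add_right (Multiset.erase_le y _))) hd
  have new : ∀ y ∈ J, expectedMovesLeft (x :: y :: K) (J.erase y)
      = expectedMoves (m - 1) (Multiset.card J - 1) := by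
    intro y hy
    have hcard := Multiset.card_erase_add_one hy
    rw [ih _ (J.erase y) ?_ (by simp only [List.length_cons]; omega), ← hcard,
      Nat.add_sub_cancel]
    rwa [← Multiset.cons_coe, ← Multiset.cons_coe, Multiset.cons_add, Multiset.cons_add,
      ← Multiset.add_cons, Multiset.cons_erase hy]
  have average := expect_unknownCards_cons_of_forall_eq (K := (K : Multiset α)) (J := J)
    (F := fun l => (movesLeft K (x :: l) : ℝ))
    ((expect_movesLeft_cons_cons_self hK hxK J).trans (by rw [ih K J hKJ hm]))
    (fun y hy => (expect_movesLeft_cons_cons_of_mem hK hxK hy J).trans (by rw [known y hy]))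
    (fun y hy => (expect_movesLeft_cons_cons_of_ne hK hxK
      (fun h => hx (Multiset.mem_add.2 (Or.inr (h ▸ hy)))) _).trans (by rw [new y hy]))
  have hm' : (K.length + 1 + 2 * Multiset.card J : ℝ) = m := mod_cast (by omega)
  have recurrence := expectedMovesPending_eq_second_card (s := m) (j := Multiset.card J)
    (by linarith [K.length.cast_nonneg (α := ℝ)])
  rw [Multiset.coe_card, hm'] at average
  refine mul_left_cancel₀ (by rw [← hm']; positivity : (m : ℝ) ≠ 0) ?_
  linear_combination average - recurrence + (2 + expectedMoves (m - 1) (Multiset.card J)) * hm'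

theorem expectedMovesLeft_eq (K : List α) (J : Multiset α) (hd : (↑K + J).Nodup) :
    expectedMovesLeft K J
      = expectedMoves ↑(K.length + 2 * Multiset.card J) (Multiset.card J) := by
  induction h : K.length + 2 * Multiset.card J using Nat.strong_induction_on generalizing K J with
  | _ m ih =>
    obtain - | n := m
    · obtain rfl : K = [] := List.length_eq_zero_iff.1 (by omega)
      obtain rfl : J = 0 := Multiset.card_eq_zero.1 (by omega)
      simp [expectedMovesLeft, unknownCards, arrangements_zero, movesLeft_nil,
        expectedMoves_zero_right]
    have hK : K.Nodup := Multiset.nodup_of_le (Multiset.le_add_right _ _) hd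
    have known : ∀ x ∈ K, expectedMovesLeft (K.erase x) J = expectedMoves n (Multiset.card J) := by
      intro x hx
      have hlen := List.length_erase_add_one hx
      refine ih n n.lt_succ_self _ _ ?_ (by omega)
      rw [← Multiset.coe_erase]
      exact Multiset.nodup_of_le (Multiset.add_le_add_right (Multiset.erase_le x _)) hd
    have new : ∀ x ∈ J, 𝔼 l ∈ arrangements (unknownCards (x ::ₘ ↑K) (J.erase x)),
        (movesLeft K (x :: l) : ℝ) = expectedMovesPending n (Multiset.card J - 1) := by
      intro x hx
      have hcard := Multiset.card_erase_add_one hx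
      rw [expect_movesLeft_cons (m := n) (fun K' J' hd' hm' => ?_) ?_ (by omega), ← hcard,
        Nat.add_sub_cancel]
      · rwa [← Multiset.add_cons, Multiset.cons_erase hx]
      · rw [ih _ (by omega) K' J' hd' rfl, ← hm', Nat.cast_succ, add_sub_cancel_right]
    have average := expect_unknownCards_of_forall_eq (K := (K : Multiset α))
      (F := fun l => (movesLeft K l : ℝ))
      (fun x hx => (expect_movesLeft_cons_of_mem hK hx J).trans (by rw [known x hx])) new
    have hn : (K.length : ℝ) + 2 * Multiset.card J = n + 1 := mod_cast h
    have hn_ne : (n + 1 : ℝ) ≠ 0 := n.cast_add_one_ne_zero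
    have recurrence := expectedMoves_eq_first_card hn_ne (j := Multiset.card J)
      (by linarith [K.length.cast_nonneg (α := ℝ)])
    rw [Multiset.coe_card, hn, ← expectedMovesLeft] at average
    rw [← hn, add_sub_cancel_right, hn, add_sub_cancel_right] at recurrence
    rw [Nat.cast_succ]
    exact mul_left_cancel₀ hn_ne (average.trans recurrence.symm)

end Moves

theorem count_ofFn {m n : ℕ} (σ : Fin m → Fin n) (a : Fin n) :
    (List.ofFn σ).count a = #{i | σ i = a} := by
  rw [← Multiset.coe_count, ← Fin.univ_val_map, Multiset.count_map, Finset.card_def,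
    Finset.filter_val]
  simp only [eq_comm]

theorem mem_arrangements_deck {n : ℕ} {l : List (Fin n)} :
    l ∈ arrangements (unknownCards 0 (univ : Finset (Fin n)).val) ↔ ∀ a, l.count a = 2 := by
  rw [mem_arrangements, Multiset.ext]
  simp [unknownCards, Multiset.count_univ]

theorem expect_deal (n : ℕ) (F : List (Fin n) → ℝ) :
    𝔼 σ : Deal n, F (List.ofFn σ.1)
      = 𝔼 l ∈ arrangements (unknownCards 0 (univ : Finset (Fin n)).val), F l := by
  refine expect_bij (fun σ _ => List.ofFn σ.1) ?_ (fun _ _ => rfl) ?_ ?_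
  · exact fun σ _ => mem_arrangements_deck.2 fun a => (count_ofFn σ.1 a).trans (σ.2 a)
  · exact fun σ _ τ _ h => Subtype.ext (List.ofFn_injective h)
  · intro l hl
    have hlen : l.length = 2 * n := by
      simpa [unknownCards] using congrArg Multiset.card (mem_arrangements.1 hl)
    obtain ⟨σ, rfl⟩ : ∃ σ : Fin (2 * n) → Fin n, List.ofFn σ = l := by
      rw [← hlen]
      exact ⟨l.get, List.ofFn_get l⟩
    exact ⟨⟨σ, fun a => by rw [← count_ofFn, mem_arrangements_deck.1 hl a]⟩, mem_univ _, rfl⟩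

theorem expectedLength_eq (n : ℕ) : expectedLength n = expectedMoves (2 * n) n := by
  have total := expectedMovesLeft_eq [] (univ : Finset (Fin n)).val (by simpa using univ.nodup)
  rw [expectedMovesLeft, Multiset.coe_nil, ← expect_deal n fun l => (movesLeft [] l : ℝ),
    Fintype.expect_eq_sum_div_card] at total
  simpa [expectedLength, gameLength] using total

/-! ### Asymptotics -/

theorem evenRunProb_add_evenRunProb_eq_one (n : ℕ) :
    evenRunProb (2 * (n + 1)) (n + 1) + evenRunProb (2 * n + 1) n = 1 := by
  have run := mul_evenRunProb (s := 2 * (n + 1)) (by positivity) (n + 1)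
  rw [Nat.add_sub_cancel, show (2 * (n + 1) - 1 : ℝ) = 2 * n + 1 by ring] at run
  push_cast at run
  refine mul_left_cancel₀ (by positivity : (2 * (n + 1) : ℝ) ≠ 0) ?_
  linear_combination run

theorem evenRunProb_two_mul_succ (n : ℕ) :
    3 * (2 * n + 1) * evenRunProb (2 * (n + 1)) (n + 1) + (2 * n + 2) * evenRunProb (2 * n) n
      = 2 * (2 * n + 1) := by
  have run := mul_evenRunProb (s := 2 * n + 1) (by positivity) (n + 1)
  have pascal := evenRunProb_pascal (s := 2 * n) (j := n) (by linarith [n.cast_nonneg (α := ℝ)])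
  rw [Nat.add_sub_cancel, add_sub_cancel_right] at run
  push_cast at run
  field_simp at pascal
  linear_combination
    3 * (2 * n + 1) * evenRunProb_add_evenRunProb_eq_one n - run + pascal

theorem evenGapProb_two_mul_succ (n : ℕ) :
    evenGapProb (2 * (n + 1)) (n + 1)
      = evenGapProb (2 * n) n + (2 * evenRunProb (2 * (n + 1)) (n + 1) - 1) / (2 * n + 3) := by
  have longer := evenGapProb_add_one (s := 2 * n) (j := n) (by linarith [n.cast_nonneg (α := ℝ)])
  have longer' := evenGapProb_add_one (s := 2 * n + 1) (j := n + 1)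
    (by push_cast; linarith [n.cast_nonneg (α := ℝ)])
  have fewer := succ_mul_evenGapProb (2 * n + 1) (n + 1)
  rw [show (2 * n + 1 + 1 : ℝ) = 2 * (n + 1) by ring] at longer' fewer
  rw [Nat.add_sub_cancel] at fewer
  push_cast at fewer
  field_simp
  linear_combination
    longer' + 2 * fewer + longer - evenRunProb_add_evenRunProb_eq_one n

theorem expectedLength_succ (n : ℕ) :
    expectedLength (n + 1)
      = 3 * n + 4 - (2 * n + 3) * evenGapProb (2 * (n + 1)) (n + 1) - evenGapProb (2 * n) n := by
  rw [expectedLength_eq, expectedMoves, luckyMatches, Nat.add_sub_cancel, Nat.cast_succ,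
    mul_add_one, add_sub_cancel_right, div_self (by positivity)]
  ring

/-- Twice the error of the approximation `1 / 2 - 1 / (8 * (2 * n + 1))` to the probability that
the initial run of a fresh deck of `2 * (n + 1)` cards has even length. The correction term makes
the inhomogeneous part of the recurrence in `evenRunError_succ` quadratically small. -/
noncomputable def evenRunError (n : ℕ) : ℝ :=
  2 * evenRunProb (2 * (n + 1)) (n + 1) - 1 + 1 / (4 * (2 * n + 1))

theorem evenRunError_zero : evenRunError 0 = -3 / 4 := by
  have even := evenRunProb_two_mul_succ 0
  norm_num [evenRunProb_zero_right] at even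
  norm_num [evenRunError, even]

theorem evenRunError_succ (n : ℕ) :
    evenRunError (n + 1)
      = 1 / (4 * (2 * n + 1) * (2 * n + 3)) - (2 * n + 4) / (3 * (2 * n + 3)) * evenRunError n := by
  have step := evenRunProb_two_mul_succ (n + 1)
  rw [evenRunError, evenRunError]
  push_cast at step ⊢
  field_simp
  linear_combination 8 * (2 * (n : ℝ) + 1) * (2 * n + 3) * step

theorem abs_evenRunError_le (n : ℕ) : |evenRunError n| ≤ 9 / ((n + 3) * (n + 4)) := by
  induction n with
  | zero => norm_num [evenRunError_zero, abs_div]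
  | succ n ih =>
    have coefficient : (2 * n + 4) / (3 * (2 * n + 3)) ≤ (4 / 9 : ℝ) := by
      rw [div_le_div_iff₀ (by positivity) (by norm_num)]
      linarith [n.cast_nonneg (α := ℝ)]
    have inhomogeneity :
        (1 / (4 * (2 * n + 1) * (2 * n + 3)) : ℝ)
          ≤ (5 * n + 7) / ((n + 3) * (n + 4) * (n + 5)) := by
      rw [div_le_div_iff₀ (by positivity) (by positivity), ← sub_nonneg]
      ring_nf
      positivity
    calc |evenRunError (n + 1)|
        ≤ |1 / (4 * (2 * (n : ℝ) + 1) * (2 * n + 3))|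
            + |(2 * n + 4) / (3 * (2 * n + 3)) * evenRunError n| :=
          evenRunError_succ n ▸ abs_sub _ _
      _ = 1 / (4 * (2 * n + 1) * (2 * n + 3))
            + (2 * n + 4) / (3 * (2 * n + 3)) * |evenRunError n| := by
          rw [abs_mul, abs_of_pos (by positivity : (0 : ℝ) < 1 / (4 * (2 * n + 1) * (2 * n + 3))),
            abs_of_pos (by positivity : (0 : ℝ) < (2 * n + 4) / (3 * (2 * n + 3)))]
      _ ≤ (5 * n + 7) / ((n + 3) * (n + 4) * (n + 5)) + 4 / 9 * (9 / ((n + 3) * (n + 4))) := by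
          gcongr
      _ = 9 / ((↑(n + 1) + 3) * (↑(n + 1) + 4)) := by
          push_cast
          field_simp
          ring

theorem sum_alternating_inv (m : ℕ) :
    ∑ i ∈ range (2 * m), (-1 : ℝ) ^ i * (1 / (i + 1)) = harmonic (2 * m) - harmonic m := by
  induction m with
  | zero => simp
  | succ m ih =>
    rw [mul_add_one, sum_range_succ, sum_range_succ, ih, harmonic_succ, harmonic_succ,
      harmonic_succ, pow_succ, pow_mul, neg_one_sq, one_pow]
    push_cast
    field_simp
    ring

theorem tendsto_sum_alternating_inv :
    Tendsto (fun m : ℕ => ∑ i ∈ range m, (-1 : ℝ) ^ i * (1 / (i + 1))) atTop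
      (𝓝 (Real.log 2)) := by
  have anti : Antitone fun i : ℕ => 1 / ((i : ℝ) + 1) := fun i j h =>
    one_div_le_one_div_of_le (by positivity) (by gcongr)
  obtain ⟨L, hL⟩ := anti.tendsto_alternating_series_of_tendsto_zero
    tendsto_one_div_add_atTop_nhds_zero_nat
  have double : Tendsto (fun m : ℕ => 2 * m) atTop atTop :=
    tendsto_id.const_mul_atTop' two_pos
  have even : Tendsto (fun m : ℕ => ∑ i ∈ range (2 * m), (-1 : ℝ) ^ i * (1 / (i + 1))) atTop
      (𝓝 (Real.log 2)) := by
    have diff := (Real.tendsto_harmonic_sub_log.comp double).sub Real.tendsto_harmonic_sub_log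
    rw [sub_self] at diff
    rw [← zero_add (Real.log 2)]
    refine (diff.add_const (Real.log 2)).congr' ?_
    filter_upwards [eventually_ne_atTop 0] with m hm
    rw [Function.comp_apply, sum_alternating_inv, Nat.cast_mul, Nat.cast_two,
      Real.log_mul two_ne_zero (Nat.cast_ne_zero.2 hm)]
    ring
  rwa [tendsto_nhds_unique (hL.comp double) even] at hL

theorem tendsto_of_tendsto_alternating_sum {ι : Type*} {p : Filter ι} {f : ι → ℕ → ℝ}
    {g : ℕ → ℝ} {S : ι → ℝ} {L : ℝ} (anti : ∀ i, Antitone (f i))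
    (hS : ∀ i, Tendsto (fun m => ∑ l ∈ range m, (-1) ^ l * f i l) atTop (𝓝 (S i)))
    (hf : ∀ l, Tendsto (fun i => f i l) p (𝓝 (g l)))
    (hg : Tendsto (fun m => ∑ l ∈ range m, (-1) ^ l * g l) atTop (𝓝 L)) :
    Tendsto S p (𝓝 L) := by
  have partial_sum (m : ℕ) : Tendsto (fun i => ∑ l ∈ range m, (-1) ^ l * f i l) p
      (𝓝 (∑ l ∈ range m, (-1) ^ l * g l)) :=
    tendsto_finsetSum _ fun l _ => (hf l).const_mul _
  have even : Tendsto (fun k : ℕ => 2 * k) atTop atTop := tendsto_id.const_mul_atTop' two_pos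
  have odd : Tendsto (fun k : ℕ => 2 * k + 1) atTop atTop :=
    tendsto_atTop_mono (fun _ => Nat.le_succ _) even
  refine tendsto_order.2 ⟨fun a ha => ?_, fun a ha => ?_⟩
  · obtain ⟨k, hk⟩ := ((hg.comp even).eventually_const_lt ha).exists
    filter_upwards [(partial_sum (2 * k)).eventually_const_lt hk] with i hi
    exact hi.trans_le ((anti i).alternating_series_le_tendsto (hS i) k)
  · obtain ⟨k, hk⟩ := ((hg.comp odd).eventually_lt_const ha).exists
    filter_upwards [(partial_sum (2 * k + 1)).eventually_lt_const hk] with i hi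
    exact ((anti i).tendsto_le_alternating_series (hS i) k).trans_lt hi

theorem runProb_nonneg {s : ℝ} {j : ℕ} (hj : (j : ℝ) ≤ s) (l : ℕ) : 0 ≤ runProb s j l := by
  obtain h | h := lt_or_ge j l
  · rw [runProb_eq_zero_of_lt s h]
  · refine prod_nonneg fun i hi => ?_
    have hij : (i : ℝ) ≤ j := mod_cast (mem_range.1 hi).le.trans h
    exact div_nonneg (by linarith) (by linarith)

theorem antitone_runProb {s : ℝ} {j : ℕ} (hj : 2 * (j : ℝ) ≤ s) : Antitone (runProb s j) := by
  refine antitone_nat_of_succ_le fun l => ?_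
  have hjs : (j : ℝ) ≤ s := by linarith [j.cast_nonneg (α := ℝ)]
  obtain h | h := lt_or_ge j (l + 1)
  · rw [runProb_eq_zero_of_lt s h]
    exact runProb_nonneg hjs l
  · have hlj : (l : ℝ) + 1 ≤ j := mod_cast h
    rw [runProb_succ]
    refine mul_le_of_le_one_right (runProb_nonneg hjs l) ?_
    rw [div_le_one (by linarith)]
    linarith [l.cast_nonneg (α := ℝ)]

theorem antitone_runProb_div_succ {s : ℝ} {j : ℕ} (hj : 2 * (j : ℝ) ≤ s) :
    Antitone fun l : ℕ => runProb s j l / (l + 1) := fun l l' h =>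
  div_le_div₀ (runProb_nonneg (by linarith [j.cast_nonneg (α := ℝ)]) l) (antitone_runProb hj h)
    (by positivity) (by gcongr)

theorem tendsto_sum_alternating_runProb (s : ℝ) (j : ℕ) :
    Tendsto (fun m => ∑ l ∈ range m, (-1) ^ l * (runProb (s + 1) j l / (l + 1))) atTop
      (𝓝 (evenGapProb s j)) := by
  refine tendsto_const_nhds.congr' ?_
  filter_upwards [eventually_ge_atTop (j + 1)] with m hm
  simpa only [evenGapProb, div_mul_eq_mul_div, mul_div_assoc] using
    sum_range_mul_runProb (fun l => (-1) ^ l / ((l : ℝ) + 1)) (s + 1) hm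

theorem tendsto_two_mul_add_atTop (c : ℝ) : Tendsto (fun n : ℕ => 2 * (n : ℝ) + c) atTop atTop :=
  tendsto_atTop_add_const_right _ _ (tendsto_natCast_atTop_atTop.const_mul_atTop two_pos)

theorem tendsto_runProb_two_mul_add (c : ℝ) (l : ℕ) :
    Tendsto (fun n : ℕ => runProb (2 * n + c) n l) atTop (𝓝 1) := by
  rw [← prod_const_one (s := range l) (M := ℝ)]
  refine tendsto_finsetProd _ fun i _ => ?_
  have vanishing := (tendsto_two_mul_add_atTop (c - i)).const_div_atTop (i + c)
  rw [← sub_zero (1 : ℝ)]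
  refine (vanishing.const_sub 1).congr' ?_
  filter_upwards [(tendsto_two_mul_add_atTop (c - i)).eventually_ne_atTop 0] with n hn
  rw [← add_sub_assoc] at hn ⊢
  rw [eq_div_iff hn, sub_mul, div_mul_cancel₀ _ hn]
  ring

theorem tendsto_evenGapProb :
    Tendsto (fun n : ℕ => evenGapProb (2 * n) n) atTop (𝓝 (Real.log 2)) :=
  tendsto_of_tendsto_alternating_sum
    (fun _ => antitone_runProb_div_succ (le_add_of_nonneg_right zero_le_one))
    (fun n => tendsto_sum_alternating_runProb (2 * n) n)
    (fun l => (tendsto_runProb_two_mul_add 1 l).div_const _) tendsto_sum_alternating_inv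

theorem abs_sub_le_of_abs_succ_sub_le {w b : ℕ → ℝ} {L : ℝ} (hw : Tendsto w atTop (𝓝 L))
    (hb : Tendsto b atTop (𝓝 0)) (h : ∀ n, |w (n + 1) - w n| ≤ b n - b (n + 1)) (n : ℕ) :
    |w n - L| ≤ b n := by
  have anti : Antitone fun n => w n + b n :=
    antitone_nat_of_succ_le fun n => by linarith [(abs_le.1 (h n)).2]
  have mono : Monotone fun n => w n - b n :=
    monotone_nat_of_le_succ fun n => by linarith [(abs_le.1 (h n)).1]
  have lower := anti.le_of_tendsto (hw.add hb) n
  have upper := mono.ge_of_tendsto (hw.sub hb) n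
  rw [abs_le]
  constructor <;> linarith

theorem abs_evenGapProb_sub_le (n : ℕ) :
    |evenGapProb (2 * n) n - 1 / (8 * (2 * n + 1)) - Real.log 2|
      ≤ 3 / (((n : ℝ) + 1) * (n + 2)) := by
  refine abs_sub_le_of_abs_succ_sub_le
    (w := fun n : ℕ => evenGapProb (2 * n) n - 1 / (8 * (2 * n + 1)))
    (b := fun n : ℕ => 3 / (((n : ℝ) + 1) * (n + 2))) ?_ ?_ (fun n => ?_) n
  · rw [← sub_zero (Real.log 2)]
    exact tendsto_evenGapProb.sub
      (((tendsto_two_mul_add_atTop 1).const_mul_atTop (by norm_num)).const_div_atTop _)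
  · have linear (c : ℝ) : Tendsto (fun n : ℕ => (n : ℝ) + c) atTop atTop :=
      tendsto_atTop_add_const_right _ _ tendsto_natCast_atTop_atTop
    exact ((linear 1).atTop_mul_atTop₀ (linear 2)).const_div_atTop _
  · have increment : evenGapProb (2 * (n + 1)) (n + 1) - 1 / (8 * (2 * (n + 1) + 1))
        - (evenGapProb (2 * n) n - 1 / (8 * (2 * n + 1))) = evenRunError n / (2 * n + 3) := by
      rw [evenGapProb_two_mul_succ, evenRunError]
      field_simp
      ring
    push_cast
    rw [increment, abs_div, abs_of_pos (by positivity : (0 : ℝ) < 2 * n + 3)]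
    calc |evenRunError n| / (2 * n + 3) ≤ 9 / ((n + 3) * (n + 4)) / (2 * n + 3) := by
          gcongr
          exact abs_evenRunError_le n
      _ ≤ 6 / ((n + 1) * (n + 2) * (n + 3)) := by
          rw [div_div, div_le_div_iff₀ (by positivity) (by positivity), ← sub_nonneg]
          ring_nf
          positivity
      _ = 3 / ((n + 1) * (n + 2)) - 3 / ((n + 1 + 1) * (n + 1 + 2)) := by
          field_simp
          ring

theorem abs_expectedLength_sub_le {n : ℕ} (hn : n ≠ 0) :
    |expectedLength n - ((3 - 2 * Real.log 2) * n + 7 / 8 - 2 * Real.log 2)| ≤ 10 / n := by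
  obtain ⟨n, rfl⟩ := Nat.exists_eq_succ_of_ne_zero hn
  have gaps := abs_evenGapProb_sub_le (n + 1)
  have gaps' := abs_evenGapProb_sub_le n
  push_cast at gaps
  rw [Nat.succ_eq_add_one, expectedLength_succ, Nat.cast_succ]
  set x := evenGapProb (2 * (n + 1)) (n + 1) - 1 / (8 * (2 * (n + 1) + 1)) - Real.log 2 with hx
  set y := evenGapProb (2 * n) n - 1 / (8 * (2 * n + 1)) - Real.log 2 with hy
  have error : 3 * n + 4 - (2 * n + 3) * evenGapProb (2 * (n + 1)) (n + 1) - evenGapProb (2 * n) n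
      - ((3 - 2 * Real.log 2) * (n + 1) + 7 / 8 - 2 * Real.log 2)
      = -((2 * n + 3) * x + y + 1 / (8 * (2 * n + 1))) := by
    rw [hx, hy]
    field_simp
    ring
  rw [error, abs_neg]
  calc |(2 * n + 3) * x + y + 1 / (8 * (2 * n + 1))|
      ≤ |(2 * n + 3) * x| + |y| + |1 / (8 * (2 * (n : ℝ) + 1))| := abs_add_three _ _ _
    _ = (2 * n + 3) * |x| + |y| + 1 / (8 * (2 * n + 1)) := by
        rw [abs_mul, abs_of_pos (by positivity : (0 : ℝ) < 2 * n + 3),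
          abs_of_pos (by positivity : (0 : ℝ) < 1 / (8 * (2 * n + 1)))]
    _ ≤ (2 * n + 3) * (3 / ((n + 1 + 1) * (n + 1 + 2))) + 3 / ((n + 1) * (n + 2))
          + 1 / (8 * (2 * n + 1)) := by gcongr
    _ ≤ 6 / (n + 1) + 3 / (n + 1) + 1 / (n + 1) := by
        gcongr ?_ + ?_ + ?_
        · rw [mul_div_assoc', div_le_div_iff₀ (by positivity) (by positivity)]
          nlinarith [n.cast_nonneg (α := ℝ)]
        · gcongr
          nlinarith [n.cast_nonneg (α := ℝ)]
        · gcongr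
          linarith [n.cast_nonneg (α := ℝ)]
    _ = 10 / (n + 1) := by ring

theorem one_div_natCast_isBigO_one_div_sqrt :
    (fun n : ℕ => 1 / (n : ℝ)) =O[atTop] fun n : ℕ => 1 / √(n : ℝ) := by
  refine Asymptotics.IsBigO.of_bound 1 ?_
  filter_upwards [eventually_ge_atTop 1] with n hn
  have hn' : (1 : ℝ) ≤ n := mod_cast hn
  rw [one_mul, Real.norm_of_nonneg (by positivity), Real.norm_of_nonneg (by positivity)]
  gcongr
  exact Real.sqrt_le_iff.2 ⟨by positivity, le_self_pow₀ hn' two_ne_zero⟩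

end SolitaireMemory

theorem mainTheorem3_general :
    ∃ ε : ℕ → ℝ,
      (∀ n : ℕ, SolitaireMemory.expectedLength n =
        (3 - 2 * Real.log 2) * (n : ℝ) + 7 / 8 - 2 * Real.log 2 + ε n) ∧
      Asymptotics.IsBigO Filter.atTop ε (fun n : ℕ => 1 / (n : ℝ)) := by
  refine ⟨fun n => SolitaireMemory.expectedLength n
    - ((3 - 2 * Real.log 2) * n + 7 / 8 - 2 * Real.log 2),
    fun n => (add_sub_cancel _ _).symm, Asymptotics.IsBigO.of_bound 10 ?_⟩
  filter_upwards [Filter.eventually_ne_atTop 0] with n hn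
  rw [Real.norm_eq_abs, Real.norm_of_nonneg (by positivity), mul_one_div]
  exact SolitaireMemory.abs_expectedLength_sub_le hn

theorem mainTheorem3 :
    ∃ ε : ℕ → ℝ,
      (∀ n : ℕ, SolitaireMemory.expectedLength n =
        (3 - 2 * Real.log 2) * (n : ℝ) + 7 / 8 - 2 * Real.log 2 + ε n) ∧
      Filter.Tendsto ε Filter.atTop (nhds 0) ∧
      Asymptotics.IsBigO Filter.atTop ε (fun n : ℕ => 1 / Real.sqrt (n : ℝ)) := by
  obtain ⟨ε, length_eq, hε⟩ := mainTheorem3_general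
  exact ⟨ε, length_eq, hε.trans_tendsto tendsto_one_div_atTop_nhds_zero_nat,
    hε.trans SolitaireMemory.one_div_natCast_isBigO_one_div_sqrt⟩
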